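/- **Setting.** Let $\mathcal F$ be a real reproducing kernel Hilbert space (RKHS) of functions on a set $\mathcal X$ with kernel $k$, let $\mathcal Y$ be a measurable space, and let $\mathcal G$ be a real RKHS of functions on $\mathcal Y$ with kernel $l$ and feature map $\phi(y)=l(y,\cdot)$, where every $l(y,\cdot)$ is measurable. Let $H$ be a set of decisions and $q:H\times\mathcal Y\to\mathbb R$ a cost function with $q(\eta,\cdot)$ measurable for each $\eta$. Given samples $(x_1,y_1),\dots,(x_N,y_N)\in\mathcal X\times\mathcal Y$, a query point $x\in\mathcal X$ and constants $\lambda>0$, $R\ge 0$, $\gamma\ge 0$, put $x_{N+1}:=x$, $K^A:=(k(x_i,x_j))_{i,j=1}^{N+1}$, $k^A_x:=(k(x_i,x))_{i=1}^{N+1}$ and $$\beta:=(k^A_x)^\top\bigl(K^A+\lambda (N+1)I\bigr)^{-1}\in\mathbb R^{N+1},\qquad \hat\mu[x]:=\sum_{i=1}^N\beta_i\,\phi(y_i),$$ $$\epsilon_x:=|\beta_{N+1}|R+\gamma(N+1)^{-1/4},\qquad \mathcal C[x]:=\{\mu\in\mathcal G:\ \|\mu-\hat\mu[x]\|_{\mathcal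 G}\le\epsilon_x\}.$$ Let $co(\mathcal Q)$ be the conic hull of the set of all probability measures on $\mathcal Y$. For $Q\in co(\mathcal Q)$, the kernel mean embedding $\int\phi\,dQ$, if it exists, is the element $m\in\mathcal G$ such that every $f\in\mathcal G$ is $Q$-integrable and $\int f\,dQ=\langle f,m\rangle_{\mathcal G}$. The conditional kernel DRO problem is $$\inf_{\eta\in H}\ \sup_{Q\in co(\mathcal Q),\ \mu\in\mathcal C[x]}\ \int_{\mathcal Y}q(\eta,y)\,Q(dy)\quad\text{s.t.}\quad \int_{\mathcal Y}1\,Q(dy)=1,\ \ \int_{\mathcal Y}\phi(y)\,Q(dy)=\mu. \tag{P}$$ All optimal values are extended real numbers, and $\int q(\eta,y)\,Q(dy)$ is an extended real number too; measures $Q$ for which it is undefined (both the positive and the negative part have infinite integral) do not count in the supremum. **Theorem.** The dual of (P) is $$\inf_{\eta\in H,\ f\in\mathcal G,\ f_0\in\mathbb R}\ f_0+\sum_{i=1}^N\beta_i f(y_i)+\epsilon_x\|f\|_{\mathcal G}\quad\text{s.t.}\quad q(\eta,y)\le f(y)+f_0\ \text{ for all }y\in\mathcal Y, \tag{D}$$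 and strong duality holds if the inner maximization is strictly feasible. Precisely: 1. For $\eta\in H$, $f\in\mathcal G$, $f_0\in\mathbb R$, the Lagrange dual function of the inner problem, $$\sup_{Q,\ \mu\in\mathcal C[x]}\ \int_{\mathcal Y} q(\eta,y)\,Q(dy)+\Bigl\langle f,\ \mu-\int_{\mathcal Y}\phi\,dQ\Bigr\rangle_{\mathcal G}+f_0\Bigl(1-\int_{\mathcal Y}1\,dQ\Bigr),$$ where $Q$ ranges over the elements of $co(\mathcal Q)$ that have a kernel mean embedding, equals $f_0+\sum_{i=1}^N\beta_if(y_i)+\epsilon_x\|f\|_{\mathcal G}$ if $q(\eta,y)\le f(y)+f_0$ for all $y\in\mathcal Y$, and equals $+\infty$ otherwise. Consequently its infimum over $(\eta,f,f_0)$ is the optimal value of (D). 2. Suppose that the inner maximization is strictly feasible, that is, some probability measure $Q$ on $\mathcal Y$ has a kernel mean embedding $\mu$ with $\|\mu-\hat\mu[x]\|_{\mathcal G}<\epsilon_x$. Then there is no duality gap. For every $\eta\in H$, the optimal value of the inner maximization in (P) equals the infimum over $(f,f_0)$ in (D) for this $\eta$, and if this value is not $+\infty$, then the infimum is attained. The optimal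 values of (P) and (D) are equal. -/

import Mathlib

open MeasureTheory
open scoped ENNReal NNReal

namespace CKDRO

noncomputable section

/-- The scalar reproducing kernel `k(x, x')` of a real RKHS `F` of functions on `X`. -/
def scalarKernel (F : Type*) {X : Type*} [NormedAddCommGroup F] [InnerProductSpace ℝ F]
    [CompleteSpace F] [RKHS ℝ F X ℝ] (x x' : X) : ℝ :=
  RKHS.kernel F x x' 1

/-- The feature map `φ(y) = l(y, ·)` of a real RKHS `G` of functions on `Y`. -/
def feature (G : Type*) {Y : Type*} [NormedAddCommGroup G] [InnerProductSpace ℝ G]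
    [CompleteSpace G] [RKHS ℝ G Y ℝ] (y : Y) : G :=
  RKHS.kerFun G y 1

/-- The augmented sample `x₁, …, x_N, x`. -/
def augmented {X : Type*} {N : ℕ} (xs : Fin N → X) (x : X) : Fin (N + 1) → X :=
  Fin.snoc (α := fun _ => X) xs x

/-- The augmented Gram matrix `K^A`. -/
def gram (F : Type*) {X : Type*} [NormedAddCommGroup F] [InnerProductSpace ℝ F]
    [CompleteSpace F] [RKHS ℝ F X ℝ] {N : ℕ} (xs : Fin N → X) (x : X) :
    Matrix (Fin (N + 1)) (Fin (N + 1)) ℝ :=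
  Matrix.of fun i j => scalarKernel F (augmented xs x i) (augmented xs x j)

/-- The weights `β = (k^A_x)ᵀ (K^A + lam (N + 1) I)⁻¹`, a vector with `N + 1` entries. -/
def weights (F : Type*) {X : Type*} [NormedAddCommGroup F] [InnerProductSpace ℝ F]
    [CompleteSpace F] [RKHS ℝ F X ℝ] {N : ℕ} (lam : ℝ) (xs : Fin N → X) (x : X) :
    Fin (N + 1) → ℝ :=
  Matrix.vecMul (fun i => scalarKernel F (augmented xs x i) x)
    (gram F xs x + (lam * ((N : ℝ) + 1)) • (1 : Matrix (Fin (N + 1)) (Fin (N + 1)) ℝ))⁻¹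

/-- The radius `ε_x = |β_{N+1}| R + γ (N + 1)^(-1/4)`. -/
def radius {N : ℕ} (β : Fin (N + 1) → ℝ) (R γ : ℝ) : ℝ :=
  |β (Fin.last N)| * R + γ * ((N : ℝ) + 1) ^ (-(1 / 4) : ℝ)

/-- The centre `μ̂[x] = ∑_{i ≤ N} β_i φ(y_i)`; the last entry of `β` does not enter. -/
def center (G : Type*) {Y : Type*} [NormedAddCommGroup G] [InnerProductSpace ℝ G]
    [CompleteSpace G] [RKHS ℝ G Y ℝ] {N : ℕ} (β : Fin (N + 1) → ℝ) (ys : Fin N → Y) : G :=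
  ∑ i : Fin N, β i.castSucc • feature G (ys i)

/-- The conic hull `co(𝒬)` of the set of all probability measures on `Y`. -/
def conicHull (Y : Type*) [MeasurableSpace Y] : Set (Measure Y) :=
  (Submodule.span ℝ≥0 {P : Measure Y | IsProbabilityMeasure P} : Submodule ℝ≥0 (Measure Y))

/-- `m = ∫ φ(y) Q(dy)`: `m` is the kernel mean embedding of `Q`, i.e. the element of `G` with
`⟨f, m⟩ = ∫ f dQ` for every `f ∈ G`. It is unique, and it is the Bochner integral of the feature
map whenever the latter exists (see `isKernelMean_iff`). -/
def IsKernelMean {G Y : Type*} [NormedAddCommGroup G] [InnerProductSpace ℝ G]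
    [CompleteSpace G] [RKHS ℝ G Y ℝ] [MeasurableSpace Y] (Q : Measure Y) (m : G) : Prop :=
  ∀ f : G, Integrable (fun y : Y => f y) Q ∧ ∫ y : Y, f y ∂Q = inner ℝ f m

theorem inner_feature {G Y : Type*} [NormedAddCommGroup G] [InnerProductSpace ℝ G]
    [CompleteSpace G] [RKHS ℝ G Y ℝ] (f : G) (y : Y) : inner ℝ f (feature G y) = f y := by
  simp [feature]

theorem isKernelMean_iff {G Y : Type*} [NormedAddCommGroup G] [InnerProductSpace ℝ G]
    [CompleteSpace G] [RKHS ℝ G Y ℝ] [MeasurableSpace Y] (Q : Measure Y)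
    (hQ : Integrable (fun y => feature G y) Q) (m : G) :
    IsKernelMean Q m ↔ ∫ y, feature G y ∂Q = m := by
  have h : ∀ f : G, ∫ y : Y, f y ∂Q = inner ℝ f (∫ y, feature G y ∂Q) := fun f => by
    rw [← integral_inner hQ f]
    simp [inner_feature]
  constructor
  · intro hm
    exact ext_inner_left ℝ fun f => by rw [← h f, (hm f).2]
  · rintro rfl f
    refine ⟨?_, h f⟩
    simpa [inner_feature] using hQ.const_inner (𝕜 := ℝ) f

/-- The integral `∫ g dQ` as an extended real: positive part minus negative part. It is the usual
integral if `g` is `Q`-integrable and `±∞` if just one part is infinite. If both parts are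
infinite, then the integral is undefined; its value here is `⊥`, so that such a `Q` does not
count in a maximization. -/
def extIntegral {Y : Type*} [MeasurableSpace Y] (Q : Measure Y) (g : Y → ℝ) : EReal :=
  ((∫⁻ y, ENNReal.ofReal (g y) ∂Q : ℝ≥0∞) : EReal) -
    ((∫⁻ y, ENNReal.ofReal (-g y) ∂Q : ℝ≥0∞) : EReal)

section Problems

variable {H Y G : Type*} [MeasurableSpace Y] [NormedAddCommGroup G] [InnerProductSpace ℝ G]
  [CompleteSpace G] [RKHS ℝ G Y ℝ]

/-- The constraints of the inner maximization over `(Q, μ)`; the ambiguity set `𝒞[x]` is the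
closed ball with centre `c` and radius `ε`. -/
def Feasible (c : G) (ε : ℝ) (Q : Measure Y) (μ : G) : Prop :=
  Q ∈ conicHull Y ∧ μ ∈ Metric.closedBall c ε ∧ ∫ _y, (1 : ℝ) ∂Q = 1 ∧ IsKernelMean Q μ

/-- Strict feasibility of the inner maximization: some feasible `μ` is in the interior of `𝒞[x]`. -/
def StrictlyFeasible (Y : Type*) {G : Type*} [MeasurableSpace Y] [NormedAddCommGroup G]
    [InnerProductSpace ℝ G] [CompleteSpace G] [RKHS ℝ G Y ℝ] (c : G) (ε : ℝ) : Prop :=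
  ∃ (Q : Measure Y) (μ : G), Feasible c ε Q μ ∧ ‖μ - c‖ < ε

/-- The optimal value of the inner maximization for the cost `g = q(η, ·)`. -/
def innerValue (c : G) (ε : ℝ) (g : Y → ℝ) : EReal :=
  ⨆ (Q : Measure Y) (μ : G) (_ : Feasible c ε Q μ), extIntegral Q g

/-- The optimal value of the conditional kernel DRO problem. -/
def primalValue (c : G) (ε : ℝ) (q : H → Y → ℝ) : EReal :=
  ⨅ η : H, innerValue c ε (q η)

/-- The Lagrangian of the inner maximization, at `Q` with kernel mean embedding `m`, at `μ`, and at
the multipliers `f₀` of `∫ 1 dQ = 1` and `f` of `∫ φ dQ = μ`. -/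
def lagrangian (g : Y → ℝ) (Q : Measure Y) (m μ f : G) (f₀ : ℝ) : EReal :=
  extIntegral Q g + ((inner ℝ f (μ - m) + f₀ * (1 - ∫ _y, (1 : ℝ) ∂Q) : ℝ) : EReal)

/-- The Lagrange dual function: the supremum of the Lagrangian over all `μ ∈ 𝒞[x]` and all
`Q ∈ co(𝒬)` that have a kernel mean embedding. -/
def dualFunction (c : G) (ε : ℝ) (g : Y → ℝ) (f : G) (f₀ : ℝ) : EReal :=
  ⨆ (Q : Measure Y) (m : G) (μ : G)
    (_ : Q ∈ conicHull Y ∧ IsKernelMean Q m ∧ μ ∈ Metric.closedBall c ε),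
    lagrangian g Q m μ f f₀

/-- The constraint `g(y) ≤ f(y) + f₀` for all `y`. -/
def DualFeasible (g : Y → ℝ) (f : G) (f₀ : ℝ) : Prop :=
  ∀ y : Y, g y ≤ f y + f₀

/-- The dual objective `f₀ + ∑_{i ≤ N} β_i f(y_i) + ε ‖f‖`. -/
def dualObjective {N : ℕ} (β : Fin (N + 1) → ℝ) (ys : Fin N → Y) (ε : ℝ) (f : G) (f₀ : ℝ) : ℝ :=
  f₀ + ∑ i : Fin N, β i.castSucc * f (ys i) + ε * ‖f‖

/-- The optimal value of the dual of the inner problem, for the cost `g = q(η, ·)`. -/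
def innerDualValue (G : Type*) {Y : Type*} [NormedAddCommGroup G] [InnerProductSpace ℝ G]
    [CompleteSpace G] [RKHS ℝ G Y ℝ] {N : ℕ} (β : Fin (N + 1) → ℝ) (ys : Fin N → Y)
    (ε : ℝ) (g : Y → ℝ) : EReal :=
  ⨅ (f : G) (f₀ : ℝ) (_ : DualFeasible g f f₀), (dualObjective β ys ε f f₀ : EReal)

/-- The optimal value of the dual problem, minimized jointly over `η`, `f` and `f₀`. -/
def dualValue (G : Type*) {H Y : Type*} [NormedAddCommGroup G] [InnerProductSpace ℝ G]
    [CompleteSpace G] [RKHS ℝ G Y ℝ] {N : ℕ} (β : Fin (N + 1) → ℝ) (ys : Fin N → Y)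
    (ε : ℝ) (q : H → Y → ℝ) : EReal :=
  ⨅ (η : H) (f : G) (f₀ : ℝ) (_ : DualFeasible (q η) f f₀),
    (dualObjective β ys ε f f₀ : EReal)

end Problems

end

end CKDRO

/-!
The dual function splits into two independent maximizations. Over the ball, the linear form
`⟨f, ·⟩` has maximum `⟨f, c⟩ + ε ‖f‖` (Cauchy–Schwarz, attained at `c + (ε / ‖f‖) f`), and
`⟨f, c⟩ = ∑ β_i f(y_i)` by the reproducing property. Over the cone of measures, the remaining term
`∫ (g - f - f₀) dQ` is nonpositive if `g ≤ f + f₀`, with value `0` at `Q = 0`; otherwise multiples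
of a point mass at a violating point make it arbitrarily large. Weak duality follows from the same
bound.

For strong duality, the pairs `(∫ φ dQ, ∫ g dQ)`, with `Q` a probability measure for which both
integrals exist, form a convex subset of `G × ℝ` (`momentSet`). If `V` is a real upper bound of the
inner problem, then this set is disjoint from the open convex set `ball c ε × (V, ∞)`. A separating
hyperplane is not vertical because the moment set has a point over the open ball, so it is the
graph of an affine function `m ↦ ⟨f, m⟩ + f₀`, whose maximum over the ball is at most `V`
(`exists_affine_majorant`). Applied to point masses, the separation says `g ≤ f + f₀`, so that
`(f, f₀)` is an optimal dual solution when `V` is the value of the inner problem.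

The cost need not be integrable for the strictly feasible measure that is given, so a further
argument is required for a moment point over the open ball, and for the inner value not to be `-∞`.
It is `exists_mem_momentSet_ball`: if all embeddings of measures integrating `g` avoided the ball,
then some `w ∈ G` would separate the point evaluations from the ball, and integrating `w` against
the given measure would be contradictory.
-/

namespace CKDRO

/-! ### Convex geometry in a Hilbert space -/

section Hilbert

variable {E : Type*} [NormedAddCommGroup E] [InnerProductSpace ℝ E]

theorem inner_le_of_mem_closedBall (w : E) {c μ : E} {ε : ℝ} (hμ : μ ∈ Metric.closedBall c ε) :
    inner ℝ w μ ≤ inner ℝ w c + ε * ‖w‖ := by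
  have h1 : inner ℝ w (μ - c) ≤ ‖w‖ * ‖μ - c‖ := real_inner_le_norm _ _
  have h2 : ‖μ - c‖ ≤ ε := mem_closedBall_iff_norm.1 hμ
  have h3 : ‖w‖ * ‖μ - c‖ ≤ ‖w‖ * ε := by gcongr
  rw [inner_sub_right] at h1
  linarith

theorem exists_mem_closedBall_inner_eq (w c : E) {ε : ℝ} (hε : 0 ≤ ε) :
    ∃ μ ∈ Metric.closedBall c ε, inner ℝ w μ = inner ℝ w c + ε * ‖w‖ := by
  rcases eq_or_ne w 0 with rfl | hw
  · exact ⟨c, Metric.mem_closedBall_self hε, by simp⟩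
  · have hn : ‖w‖ ≠ 0 := norm_ne_zero_iff.2 hw
    refine ⟨c + (ε / ‖w‖) • w, ?_, ?_⟩
    · rw [mem_closedBall_iff_norm, add_sub_cancel_left, norm_smul, Real.norm_eq_abs,
        abs_of_nonneg (by positivity), div_mul_cancel₀ _ hn]
    · rw [inner_add_right, real_inner_smul_right, real_inner_self_eq_norm_sq]
      field_simp

variable [CompleteSpace E]

/-- A convex set `S ⊆ E × ℝ` whose part over the closed ball lies below the height `V`, and which
has a point over the open ball, lies below the graph of an affine function whose maximum over the
ball is at most `V`. The point over the open ball excludes a vertical separating hyperplane. -/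
theorem exists_affine_majorant {S : Set (E × ℝ)} (hS : Convex ℝ S) {c : E} {ε V : ℝ}
    (hV : ∀ p ∈ S, p.1 ∈ Metric.closedBall c ε → p.2 ≤ V)
    (hne : ∃ p ∈ S, p.1 ∈ Metric.ball c ε) :
    ∃ (w : E) (u : ℝ), (∀ p ∈ S, p.2 ≤ inner ℝ w p.1 + u) ∧
      u + inner ℝ w c + ε * ‖w‖ ≤ V := by
  obtain ⟨p₀, hp₀S, hp₀⟩ := hne
  have hε : 0 < ε := Metric.pos_of_mem_ball hp₀
  have hdisj : Disjoint (Metric.ball c ε ×ˢ Set.Ioi V) S := by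
    rw [Set.disjoint_left]
    rintro p ⟨hp1, hp2⟩ hpS
    exact absurd (hV p hpS (Metric.ball_subset_closedBall hp1)) (not_le.2 hp2)
  obtain ⟨L, u, hL, hU⟩ := geometric_hahn_banach_open
    ((convex_ball c ε).prod (convex_Ioi V)) (Metric.isOpen_ball.prod isOpen_Ioi) hS hdisj
  obtain ⟨v, hv⟩ : ∃ v : E, ∀ m : E, L (m, 0) = inner ℝ v m :=
    ⟨(InnerProductSpace.toDual ℝ E).symm (L.comp (ContinuousLinearMap.inl ℝ E ℝ)),
      fun m => by simp⟩
  set s : ℝ := L (0, 1) with hs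
  have hLs : ∀ (m : E) (t : ℝ), L (m, t) = inner ℝ v m + t * s := fun m t => by
    have : ((m, t) : E × ℝ) = (m, 0) + t • ((0, 1) : E × ℝ) := by simp
    rw [this, map_add, map_smul, hv, smul_eq_mul]
  -- Compare the point of `S` over the open ball with points far above it.
  have hs_neg : s < 0 := by
    by_contra! hcon
    have h1 := hU p₀ hp₀S
    have h2 := hL (p₀.1, max V p₀.2 + 1) ⟨hp₀, Set.mem_Ioi.2 (lt_of_le_of_lt (le_max_left _ _) (lt_add_one _))⟩
    rw [← Prod.mk.eta (p := p₀), hLs] at h1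
    rw [hLs] at h2
    have h3 : p₀.2 * s ≤ (max V p₀.2 + 1) * s :=
      mul_le_mul_of_nonneg_right (by linarith [le_max_right V p₀.2]) hcon
    linarith
  have hr : 0 < (-s)⁻¹ := inv_pos.2 (neg_pos.2 hs_neg)
  have hrs : (-s)⁻¹ * s = -1 := by
    rw [inv_neg, neg_mul, inv_mul_cancel₀ hs_neg.ne]
  refine ⟨(-s)⁻¹ • v, -((-s)⁻¹ * u), fun p hp => ?_, ?_⟩
  · have h1 := hU p hp
    rw [← Prod.mk.eta (p := p), hLs] at h1
    have h2 := mul_le_mul_of_nonneg_left h1 hr.le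
    rw [real_inner_smul_left]
    linear_combination h2 + p.2 * hrs
  · have hball : ∀ m ∈ Metric.ball c ε,
        inner ℝ ((-s)⁻¹ • v) m ≤ V + (-s)⁻¹ * u := fun m hm => by
      refine le_of_forall_pos_le_add fun δ hδ => ?_
      have h1 := hL (m, V + δ) ⟨hm, by simpa using hδ⟩
      rw [hLs] at h1
      have h2 := mul_le_mul_of_nonneg_left h1.le hr.le
      rw [real_inner_smul_left]
      linear_combination h2 - (V + δ) * hrs
    have hcl : Metric.closedBall c ε ⊆
        {m | inner ℝ ((-s)⁻¹ • v) m ≤ V + (-s)⁻¹ * u} := by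
      rw [← closure_ball c hε.ne']
      exact closure_minimal hball (isClosed_le (by fun_prop) continuous_const)
    obtain ⟨μ, hμ, hμe⟩ := exists_mem_closedBall_inner_eq ((-s)⁻¹ • v) c hε.le
    have h : inner ℝ ((-s)⁻¹ • v) μ ≤ V + (-s)⁻¹ * u := hcl hμ
    linarith

end Hilbert

/-! ### Extended integrals and the cone of measures -/

section Measures

variable {Y : Type*} [MeasurableSpace Y]

theorem extIntegral_mono {Q : Measure Y} {g h : Y → ℝ} (hgh : ∀ y, g y ≤ h y) :
    extIntegral Q g ≤ extIntegral Q h := by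
  refine EReal.sub_le_sub ?_ ?_
  · exact EReal.coe_ennreal_le_coe_ennreal_iff.2
      (lintegral_mono fun y => ENNReal.ofReal_le_ofReal (hgh y))
  · exact EReal.coe_ennreal_le_coe_ennreal_iff.2
      (lintegral_mono fun y => ENNReal.ofReal_le_ofReal (neg_le_neg (hgh y)))

theorem extIntegral_eq_integral {Q : Measure Y} {g : Y → ℝ} (hg : Integrable g Q) :
    extIntegral Q g = ((∫ y, g y ∂Q : ℝ) : EReal) := by
  have h1 : ∫⁻ y, ENNReal.ofReal (g y) ∂Q ≠ ∞ := hg.lintegral_lt_top.ne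
  have h2 : ∫⁻ y, ENNReal.ofReal (-g y) ∂Q ≠ ∞ := hg.neg.lintegral_lt_top.ne
  rw [extIntegral, integral_eq_lintegral_pos_part_sub_lintegral_neg_part hg, EReal.coe_sub,
    EReal.coe_ennreal_toReal h1, EReal.coe_ennreal_toReal h2]

theorem mem_conicHull_of_isProbabilityMeasure (Q : Measure Y) [hQ : IsProbabilityMeasure Q] :
    Q ∈ conicHull Y :=
  Submodule.subset_span hQ

theorem smul_mem_conicHull (t : ℝ≥0) {Q : Measure Y} (hQ : Q ∈ conicHull Y) :
    t • Q ∈ conicHull Y :=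
  Submodule.smul_mem _ t hQ

theorem isFiniteMeasure_of_mem_conicHull {Q : Measure Y} (hQ : Q ∈ conicHull Y) :
    IsFiniteMeasure Q := by
  refine Submodule.span_induction (p := fun Q _ => IsFiniteMeasure Q) ?_ ?_ ?_ ?_ hQ
  · intro P hP
    have : IsProbabilityMeasure P := hP
    infer_instance
  · infer_instance
  · intro P P' _ _ _ _
    infer_instance
  · intro t P _ _
    infer_instance

theorem integrable_dirac_of_measurable {g : Y → ℝ} (hg : Measurable g) (y : Y) :
    Integrable g (Measure.dirac y) :=
  integrable_dirac' hg.stronglyMeasurable (by simp)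

end Measures

/-! ### Kernel mean embeddings -/

section Center

variable {Y G : Type*} [NormedAddCommGroup G] [InnerProductSpace ℝ G] [CompleteSpace G]
  [RKHS ℝ G Y ℝ]

theorem inner_center {N : ℕ} (β : Fin (N + 1) → ℝ) (ys : Fin N → Y) (f : G) :
    inner ℝ f (center G β ys) = ∑ i : Fin N, β i.castSucc * f (ys i) := by
  simp [center, inner_sum, real_inner_smul_right, inner_feature]

theorem dualObjective_eq {N : ℕ} (β : Fin (N + 1) → ℝ) (ys : Fin N → Y) (ε : ℝ) (f : G) (f₀ : ℝ) :
    dualObjective β ys ε f f₀ = f₀ + inner ℝ f (center G β ys) + ε * ‖f‖ := by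
  rw [dualObjective, inner_center]

end Center

section Kernel

variable {Y G : Type*} [MeasurableSpace Y] [NormedAddCommGroup G] [InnerProductSpace ℝ G]
  [CompleteSpace G] [RKHS ℝ G Y ℝ]

/-- The kernel sections span a dense subspace of `G`, and convergence in `G` implies pointwise
convergence. -/
theorem measurable_of_measurable_kernel
    (hl : ∀ y : Y, Measurable (fun y' : Y => scalarKernel G y y')) (f : G) :
    Measurable (fun y : Y => f y) := by
  have hspan : ∀ h ∈ Submodule.span ℝ {RKHS.kerFun G y v | (y : Y) (v : ℝ)},
      Measurable (fun y : Y => h y) := by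
    intro h hh
    induction hh using Submodule.span_induction with
    | mem h hh =>
      obtain ⟨y, v, rfl⟩ := hh
      have : (fun y' : Y => (RKHS.kerFun G y v) y') = fun y' => v * scalarKernel G y y' := by
        funext y'
        have h1 : inner ℝ (RKHS.kerFun G y v) (RKHS.kerFun G y' (1 : ℝ)) =
            RKHS.kerFun G y v y' := by simp
        have h2 : scalarKernel G y y' = inner ℝ (RKHS.kerFun G y' 1) (RKHS.kerFun G y (1 : ℝ)) := by
          rw [← RKHS.kernel_inner]; simp [scalarKernel]
        have h3 : RKHS.kerFun G y v = v • RKHS.kerFun G y (1 : ℝ) := by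
          rw [← map_smul]; simp
        rw [← h1, h2, h3, real_inner_smul_left, real_inner_comm]
      rw [this]
      exact (hl y).const_mul v
    | zero => simp
    | add a b _ _ ha hb =>
      rw [RKHS.coe_add]
      exact ha.add hb
    | smul t a _ ha => simpa using ha.const_mul t
  have hf : f ∈ (Submodule.span ℝ {RKHS.kerFun G y v | (y : Y) (v : ℝ)}).topologicalClosure := by
    rw [RKHS.kerFun_dense]; trivial
  obtain ⟨a, ha, hlim⟩ := mem_closure_iff_seq_limit.1 hf
  refine measurable_of_tendsto_metrizable (fun n => hspan (a n) (ha n)) (tendsto_pi_nhds.2 ?_)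
  intro y
  exact ((RKHS.continuous_eval (H := G) y).tendsto f).comp hlim

theorem isKernelMean_zero : IsKernelMean (0 : Measure Y) (0 : G) := fun f => by simp

theorem isKernelMean_dirac (hm : ∀ f : G, Measurable (fun y : Y => f y)) (y : Y) :
    IsKernelMean (Measure.dirac y) (feature G y) := fun f =>
  ⟨integrable_dirac_of_measurable (hm f) y, by
    rw [integral_dirac' _ _ (hm f).stronglyMeasurable, inner_feature]⟩

theorem IsKernelMean.smul {Q : Measure Y} {m : G} (h : IsKernelMean Q m) (t : ℝ≥0) :
    IsKernelMean (t • Q) ((t : ℝ) • m) := fun f =>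
  ⟨(h f).1.smul_measure_nnreal, by
    rw [integral_smul_nnreal_measure, (h f).2, real_inner_smul_right]; rfl⟩

theorem IsKernelMean.add {Q Q' : Measure Y} {m m' : G} (h : IsKernelMean Q m)
    (h' : IsKernelMean Q' m') : IsKernelMean (Q + Q') (m + m') := fun f =>
  ⟨(h f).1.add_measure (h' f).1, by
    rw [integral_add_measure (h f).1 (h' f).1, (h f).2, (h' f).2, inner_add_right]⟩

/-- Members of the cone are finite measures, so the Bochner integral `∫ 1 dQ` is the true mass
rather than the junk value `0` of an infinite measure. -/
theorem Feasible.isProbabilityMeasure {c : G} {ε : ℝ} {Q : Measure Y} {μ : G}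
    (h : Feasible c ε Q μ) : IsProbabilityMeasure Q := by
  have := isFiniteMeasure_of_mem_conicHull h.1
  have h1 := h.2.2.1
  rw [integral_const, smul_eq_mul, mul_one] at h1
  exact isProbabilityMeasure_iff_real.2 h1

/-! ### The dual function and weak duality -/

/-- Integration of the dual constraint against a measure of the cone. -/
theorem extIntegral_le_of_dualFeasible {g : Y → ℝ} {f : G} {f₀ : ℝ} (hf : DualFeasible g f f₀)
    {Q : Measure Y} (hQ : Q ∈ conicHull Y) {m : G} (hm : IsKernelMean Q m) :
    extIntegral Q g ≤ ((inner ℝ f m + f₀ * ∫ _y, (1 : ℝ) ∂Q : ℝ) : EReal) := by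
  have := isFiniteMeasure_of_mem_conicHull hQ
  refine (extIntegral_mono hf).trans_eq ?_
  have hint : Integrable (fun y => f y + f₀) Q := (hm f).1.add (integrable_const f₀)
  rw [extIntegral_eq_integral hint, integral_add (hm f).1 (integrable_const f₀), (hm f).2]
  simp [mul_comm]

theorem dualFunction_of_dualFeasible {c : G} {ε : ℝ} (hε : 0 ≤ ε) {g : Y → ℝ} {f : G} {f₀ : ℝ}
    (hf : DualFeasible g f f₀) :
    dualFunction c ε g f f₀ = ((f₀ + inner ℝ f c + ε * ‖f‖ : ℝ) : EReal) := by
  apply le_antisymm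
  · refine iSup_le fun Q => iSup_le fun m => iSup_le fun μ => iSup_le fun ⟨hQ, hm, hμ⟩ => ?_
    refine (add_le_add (extIntegral_le_of_dualFeasible hf hQ hm) le_rfl).trans ?_
    rw [← EReal.coe_add, EReal.coe_le_coe_iff, inner_sub_right]
    linarith [inner_le_of_mem_closedBall f hμ]
  · obtain ⟨μ, hμ, hμe⟩ := exists_mem_closedBall_inner_eq f c hε
    refine le_iSup_of_le 0 (le_iSup_of_le 0 (le_iSup_of_le μ (le_iSup_of_le
      ⟨Submodule.zero_mem _, isKernelMean_zero, hμ⟩ (le_of_eq ?_))))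
    have h0 : extIntegral (0 : Measure Y) g = 0 := by simp [extIntegral]
    rw [lagrangian, h0, zero_add, EReal.coe_eq_coe_iff, sub_zero, hμe]
    simp
    ring

theorem dualFunction_of_not_dualFeasible (hm : ∀ f : G, Measurable (fun y : Y => f y))
    {c : G} {ε : ℝ} (hε : 0 ≤ ε) {g : Y → ℝ} (hg : Measurable g) {f : G} {f₀ : ℝ}
    (hf : ¬ DualFeasible g f f₀) : dualFunction c ε g f f₀ = ⊤ := by
  simp only [DualFeasible, not_forall, not_le] at hf
  obtain ⟨y, hy⟩ := hf
  refine EReal.eq_top_iff_forall_lt _ |>.2 fun b => ?_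
  have hd : 0 < g y - (f y + f₀) := sub_pos.2 hy
  obtain ⟨n, hn⟩ := exists_nat_gt ((b - (inner ℝ f c + f₀)) / (g y - (f y + f₀)))
  rw [div_lt_iff₀ hd] at hn
  -- At `n` times the point mass at `y`, the Lagrangian is `n (g y - f y - f₀) + ⟨f, c⟩ + f₀`.
  set Q : Measure Y := (n : ℝ≥0) • Measure.dirac y with hQ
  have hgQ : Integrable g Q := (integrable_dirac_of_measurable hg y).smul_measure_nnreal
  have hgi : ∫ z, g z ∂Q = n * g y := by
    rw [hQ, integral_smul_nnreal_measure, integral_dirac' _ _ hg.stronglyMeasurable]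
    simp [NNReal.smul_def]
  have h1 : ∫ _z, (1 : ℝ) ∂Q = n := by
    rw [hQ, integral_smul_nnreal_measure]
    simp [NNReal.smul_def]
  refine lt_of_lt_of_le ?_ (le_iSup_of_le Q (le_iSup_of_le (((n : ℝ≥0) : ℝ) • feature G y)
    (le_iSup_of_le c (le_iSup_of_le
      ⟨smul_mem_conicHull _ (mem_conicHull_of_isProbabilityMeasure _),
        (isKernelMean_dirac hm y).smul _, Metric.mem_closedBall_self hε⟩ le_rfl))))
  rw [lagrangian, extIntegral_eq_integral hgQ, ← EReal.coe_add, EReal.coe_lt_coe_iff, hgi, h1,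
    inner_sub_right, real_inner_smul_right, inner_feature, NNReal.coe_natCast]
  linarith

/-- Weak duality. -/
theorem innerValue_le_of_dualFeasible {c : G} {ε : ℝ} {g : Y → ℝ} {f : G} {f₀ : ℝ}
    (hf : DualFeasible g f f₀) :
    innerValue c ε g ≤ ((f₀ + inner ℝ f c + ε * ‖f‖ : ℝ) : EReal) := by
  refine iSup_le fun Q => iSup_le fun μ => iSup_le fun ⟨hQ, hμ, h1, hm⟩ => ?_
  refine (extIntegral_le_of_dualFeasible hf hQ hm).trans ?_
  rw [EReal.coe_le_coe_iff, h1]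
  linarith [inner_le_of_mem_closedBall f hμ]

/-! ### The moment set and strong duality -/

variable (G) in
/-- The pairs `(∫ φ dQ, ∫ g dQ)`, where `Q` runs over the probability measures that have a kernel
mean embedding and integrate `g`. -/
def momentSet (g : Y → ℝ) : Set (G × ℝ) :=
  {p | ∃ Q : Measure Y, IsProbabilityMeasure Q ∧ IsKernelMean Q p.1 ∧ Integrable g Q ∧
    ∫ y, g y ∂Q = p.2}

theorem convex_momentSet (g : Y → ℝ) : Convex ℝ (momentSet G g) := by
  rintro p ⟨Q, hQ, hm, hg, hgi⟩ p' ⟨Q', hQ', hm', hg', hgi'⟩ a b ha hb hab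
  lift a to ℝ≥0 using ha
  lift b to ℝ≥0 using hb
  refine ⟨a • Q + b • Q', ⟨?_⟩, (hm.smul a).add (hm'.smul b),
    hg.smul_measure_nnreal.add_measure hg'.smul_measure_nnreal, ?_⟩
  · have : a + b = 1 := by exact_mod_cast hab
    simp only [Measure.coe_add, Measure.coe_nnreal_smul_apply, Pi.add_apply, measure_univ, mul_one]
    exact_mod_cast this
  · rw [integral_add_measure hg.smul_measure_nnreal hg'.smul_measure_nnreal,
      integral_smul_nnreal_measure, integral_smul_nnreal_measure, hgi, hgi']
    rfl

theorem feature_mem_momentSet (hm : ∀ f : G, Measurable (fun y : Y => f y)) {g : Y → ℝ}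
    (hg : Measurable g) (y : Y) : (feature G y, g y) ∈ momentSet G g :=
  ⟨Measure.dirac y, inferInstance, isKernelMean_dirac hm y, integrable_dirac_of_measurable hg y,
    integral_dirac' _ _ hg.stronglyMeasurable⟩

theorem le_innerValue_of_mem_momentSet {c : G} {ε : ℝ} {g : Y → ℝ} {p : G × ℝ}
    (hp : p ∈ momentSet G g) (hpc : p.1 ∈ Metric.closedBall c ε) :
    (p.2 : EReal) ≤ innerValue c ε g := by
  obtain ⟨Q, hQ, hm, hg, hgi⟩ := hp
  refine le_iSup_of_le Q (le_iSup_of_le p.1 (le_iSup_of_le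
    ⟨mem_conicHull_of_isProbabilityMeasure Q, hpc, by simp, hm⟩ (le_of_eq ?_)))
  rw [extIntegral_eq_integral hg, hgi]

/-- Strict feasibility survives the restriction to measures that integrate the cost. -/
theorem exists_mem_momentSet_ball (hm : ∀ f : G, Measurable (fun y : Y => f y)) {c : G} {ε : ℝ}
    (hsf : StrictlyFeasible Y c ε) {g : Y → ℝ} (hg : Measurable g) :
    ∃ p ∈ momentSet G g, p.1 ∈ Metric.ball c ε := by
  obtain ⟨Q, μ, hF, hμ⟩ := hsf
  have hQ := hF.isProbabilityMeasure
  by_contra! hcon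
  have hdisj : Disjoint (Metric.ball c ε) (Prod.fst '' momentSet G g) := by
    rw [Set.disjoint_right]
    rintro _ ⟨p, hp, rfl⟩
    exact hcon p hp
  obtain ⟨L, u, hL, hU⟩ := geometric_hahn_banach_open (convex_ball c ε) Metric.isOpen_ball
    ((convex_momentSet g).linear_image (LinearMap.fst ℝ G ℝ)) hdisj
  set w : G := (InnerProductSpace.toDual ℝ G).symm L
  have hw : ∀ m : G, L m = inner ℝ w m := fun m =>
    (InnerProductSpace.toDual_symm_apply (𝕜 := ℝ)).symm
  have hle : ∀ y : Y, u ≤ w y := fun y => by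
    have := hU _ ⟨_, feature_mem_momentSet hm hg y, rfl⟩
    simpa [hw, inner_feature] using this
  have h1 : inner ℝ w μ < u := by
    rw [← hw]; exact hL μ (mem_ball_iff_norm.2 hμ)
  have h2 : u ≤ ∫ y, w y ∂Q := by
    simpa using integral_mono (integrable_const u) (hF.2.2.2 w).1 hle
  rw [(hF.2.2.2 w).2] at h2
  exact absurd h1 (not_lt.2 h2)

/-- Strong duality with dual attainment. -/
theorem exists_dual_optimal (hm : ∀ f : G, Measurable (fun y : Y => f y)) {c : G} {ε : ℝ}
    (hsf : StrictlyFeasible Y c ε) {g : Y → ℝ} (hg : Measurable g)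
    (htop : innerValue c ε g ≠ ⊤) :
    ∃ (f : G) (f₀ : ℝ), DualFeasible g f f₀ ∧
      ((f₀ + inner ℝ f c + ε * ‖f‖ : ℝ) : EReal) = innerValue c ε g := by
  obtain ⟨p, hp, hpc⟩ := exists_mem_momentSet_ball hm hsf hg
  have hbot : innerValue c ε g ≠ ⊥ := ne_bot_of_le_ne_bot (EReal.coe_ne_bot p.2)
    (le_innerValue_of_mem_momentSet hp (Metric.ball_subset_closedBall hpc))
  have hV := EReal.coe_toReal htop hbot
  obtain ⟨f, f₀, hf, hle⟩ := exists_affine_majorant (convex_momentSet g)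
    (c := c) (ε := ε) (V := (innerValue c ε g).toReal)
    (fun p hp hpc => by
      rw [← EReal.coe_le_coe_iff, hV]
      exact le_innerValue_of_mem_momentSet hp hpc)
    ⟨p, hp, hpc⟩
  have hfeas : DualFeasible g f f₀ := fun y => by
    simpa [inner_feature] using hf _ (feature_mem_momentSet hm hg y)
  refine ⟨f, f₀, hfeas, le_antisymm ?_ (innerValue_le_of_dualFeasible hfeas)⟩
  rw [← hV]
  exact EReal.coe_le_coe_iff.2 hle

end Kernel

theorem radius_nonneg {N : ℕ} (β : Fin (N + 1) → ℝ) {R γ : ℝ} (hR : 0 ≤ R) (hγ : 0 ≤ γ) :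
    0 ≤ radius β R γ := by
  rw [radius]
  positivity

end CKDRO

open CKDRO in
theorem mainTheorem1 {X Y H F G : Type*} [MeasurableSpace Y]
    [NormedAddCommGroup F] [InnerProductSpace ℝ F] [CompleteSpace F] [RKHS ℝ F X ℝ]
    [NormedAddCommGroup G] [InnerProductSpace ℝ G] [CompleteSpace G] [RKHS ℝ G Y ℝ]
    (hl : ∀ y : Y, Measurable (fun y' : Y => scalarKernel G y y'))
    (q : H → Y → ℝ) (hq : ∀ η, Measurable (q η))
    {N : ℕ} (xs : Fin N → X) (ys : Fin N → Y) (x : X)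
    (lam R γ : ℝ) (hlam : 0 < lam) (hR : 0 ≤ R) (hγ : 0 ≤ γ)
    (β : Fin (N + 1) → ℝ) (hβ : β = weights F lam xs x)
    (ε : ℝ) (hε : ε = radius β R γ)
    (c : G) (hc : c = center G β ys) :
    -- the Lagrange dual of the inner problem is the stated dual
    (∀ (η : H) (f : G) (f₀ : ℝ),
      (DualFeasible (q η) f f₀ →
        dualFunction c ε (q η) f f₀ = (dualObjective β ys ε f f₀ : EReal)) ∧
      (¬ DualFeasible (q η) f f₀ → dualFunction c ε (q η) f f₀ = ⊤)) ∧
    (⨅ (η : H) (f : G) (f₀ : ℝ), dualFunction c ε (q η) f f₀) = dualValue G β ys ε q ∧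
    -- strong duality
    (StrictlyFeasible Y c ε →
      (∀ η : H, innerValue c ε (q η) = innerDualValue G β ys ε (q η)) ∧
      (∀ η : H, innerValue c ε (q η) ≠ ⊤ →
        ∃ (f : G) (f₀ : ℝ), DualFeasible (q η) f f₀ ∧
          (dualObjective β ys ε f f₀ : EReal) = innerValue c ε (q η)) ∧
      primalValue c ε q = dualValue G β ys ε q) := by
  have hm : ∀ f : G, Measurable (fun y : Y => f y) := measurable_of_measurable_kernel hl
  have hε0 : 0 ≤ ε := hε ▸ radius_nonneg β hR hγ
  have hobj : ∀ (f : G) (f₀ : ℝ),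
      dualObjective β ys ε f f₀ = f₀ + inner ℝ f c + ε * ‖f‖ := fun f f₀ => by
    rw [hc, dualObjective_eq]
  have hdual : ∀ (η : H) (f : G) (f₀ : ℝ),
      (DualFeasible (q η) f f₀ →
        dualFunction c ε (q η) f f₀ = (dualObjective β ys ε f f₀ : EReal)) ∧
      (¬ DualFeasible (q η) f f₀ → dualFunction c ε (q η) f f₀ = ⊤) := fun η f f₀ =>
    ⟨fun hf => by rw [hobj, dualFunction_of_dualFeasible hε0 hf],
      fun hf => dualFunction_of_not_dualFeasible hm hε0 (hq η) hf⟩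
  refine ⟨hdual, ?_, fun hsf => ?_⟩
  · refine iInf_congr fun η => iInf_congr fun f => iInf_congr fun f₀ => ?_
    by_cases hf : DualFeasible (q η) f f₀
    · simp [hf, (hdual η f f₀).1 hf]
    · simp [hf, (hdual η f f₀).2 hf]
  · have hopt : ∀ η : H, innerValue c ε (q η) ≠ ⊤ →
        ∃ (f : G) (f₀ : ℝ), DualFeasible (q η) f f₀ ∧
          (dualObjective β ys ε f f₀ : EReal) = innerValue c ε (q η) := fun η htop => by
      simpa only [hobj] using exists_dual_optimal hm hsf (hq η) htop
    have hval : ∀ η : H, innerValue c ε (q η) = innerDualValue G β ys ε (q η) := fun η => by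
      apply le_antisymm
      · refine le_iInf fun f => le_iInf fun f₀ => le_iInf fun hf => ?_
        rw [hobj]
        exact innerValue_le_of_dualFeasible hf
      · by_cases htop : innerValue c ε (q η) = ⊤
        · rw [htop]
          exact le_top
        · obtain ⟨f, f₀, hf, he⟩ := hopt η htop
          rw [← he]
          exact iInf_le_of_le f (iInf_le_of_le f₀ (iInf_le _ hf))
    exact ⟨hval, hopt, iInf_congr hval⟩
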